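/- Fix a constant $\rho_0\in(0,1)$. For each $n$, let $X=(X_1,\dots,X_n)$ be a Gaussian vector with $\mathbb{E}[X_i]=0$ and $\operatorname{var}(X_i)=1$ for all $1\le i\le n$, whose correlation matrix $R\in\mathbb{R}^{n\times n}$ satisfies $R_{ij}=\rho_0$ for all $i\neq j$. Let $M_n(X)=\max_{1\le i\le n}X_i$, and let $\operatorname{med}[M_n(X)]$ denote any median of $M_n(X)$. Then $$\lim_{n\to\infty}\ \frac{\operatorname{med}[M_n(X)]^2}{\operatorname{var}[M_n(X)]}\cdot\frac{1}{2\log(n)}\ =\ \frac{1-\rho_0}{\rho_0}.$$ -/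

import Mathlib

open MeasureTheory ProbabilityTheory Filter Topology

/-- The maximum `M_n(x) = max_{1 ≤ i ≤ n} x_i` of the coordinates of a vector (a supremum over the
finite index set, hence attained as soon as `1 ≤ n`). -/
noncomputable def maxCoord {n : ℕ} (x : Fin n → ℝ) : ℝ := ⨆ i, x i

/-- The correlation matrix of a random vector `X`, with entries
`cov(X_i, X_j) / (√var(X_i) √var(X_j))`. -/
noncomputable def corrMatrix {n : ℕ} {Ω : Type*} [MeasurableSpace Ω] (P : Measure Ω)
    (X : Ω → Fin n → ℝ) : Matrix (Fin n) (Fin n) ℝ :=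
  Matrix.of fun i j =>
    cov[fun ω => X ω i, fun ω => X ω j; P] /
      (√(Var[fun ω => X ω i; P]) * √(Var[fun ω => X ω j; P]))

/-- `m` is a median of the real random variable `Y`: both `P(Y ≤ m)` and `P(Y ≥ m)` are at
least `1/2`. -/
def IsMedian {Ω : Type*} [MeasurableSpace Ω] (P : Measure Ω) (Y : Ω → ℝ) (m : ℝ) : Prop :=
  1 / 2 ≤ P {ω | Y ω ≤ m} ∧ 1 / 2 ≤ P {ω | m ≤ Y ω}

/-! An equicorrelated Gaussian vector has the law of `X i = √ρ * Z + √(1 - ρ) * ξ i` with `Z` and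
the `ξ i` independent standard Gaussian variables, so that `max X = √ρ * Z + √(1 - ρ) * max ξ`.
Bounding the second moment of `max ξ - √(2 log n)`, by exponential moments on the upper tail and by
independence on the lower tail, shows that it tends to `0`. Hence `Var (max X) → ρ` and
`E (max X) / √(2 log n) → √(1 - ρ)`; by the Chebyshev inequality a median of `max X` differs from
its mean by at most `√(2 Var (max X))`, so it has the same asymptotics as the mean. -/

section Prod

variable {Ω Ω' : Type*} [MeasurableSpace Ω] [MeasurableSpace Ω'] {μ : Measure Ω} {ν : Measure Ω'}
  [IsProbabilityMeasure μ] [IsProbabilityMeasure ν]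

lemma integral_fst_add_snd_prod {E : Type*} [NormedAddCommGroup E] [NormedSpace ℝ E] {f : Ω → E}
    {g : Ω' → E} (hf : Integrable f μ) (hg : Integrable g ν) :
    ∫ p, f p.1 + g p.2 ∂(μ.prod ν) = ∫ x, f x ∂μ + ∫ y, g y ∂ν := by
  rw [integral_add (hf.comp_fst ν) (hg.comp_snd μ), integral_fun_fst, integral_fun_snd]
  simp

lemma covariance_fst_add_snd_prod {f f' : Ω → ℝ} {g g' : Ω' → ℝ} (hf : MemLp f 2 μ)
    (hf' : MemLp f' 2 μ) (hg : MemLp g 2 ν) (hg' : MemLp g' 2 ν) :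
    cov[fun p => f p.1 + g p.2, fun p => f' p.1 + g' p.2; μ.prod ν] =
      cov[f, f'; μ] + cov[g, g'; ν] := by
  have hfst : MemLp (fun p : Ω × Ω' => f p.1) 2 (μ.prod ν) := hf.comp_fst ν
  have hfst' : MemLp (fun p : Ω × Ω' => f' p.1) 2 (μ.prod ν) := hf'.comp_fst ν
  have hsnd : MemLp (fun p : Ω × Ω' => g p.2) 2 (μ.prod ν) := hg.comp_snd μ
  have hsnd' : MemLp (fun p : Ω × Ω' => g' p.2) 2 (μ.prod ν) := hg'.comp_snd μ
  calc _ = cov[fun p => f p.1, fun p => f' p.1; μ.prod ν] +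
          cov[fun p => f p.1, fun p => g' p.2; μ.prod ν] +
          (cov[fun p => g p.2, fun p => f' p.1; μ.prod ν] +
            cov[fun p => g p.2, fun p => g' p.2; μ.prod ν]) := by
        rw [← covariance_add_right hfst hfst' hsnd', ← covariance_add_right hsnd hfst' hsnd']
        exact covariance_add_left hfst hsnd (hfst'.add hsnd')
    _ = _ := by
        rw [covariance_fst_snd_prod hf hg', covariance_comm (fun p : Ω × Ω' => g p.2),
          covariance_fst_snd_prod hf' hg,
          measurePreserving_fst.hasLaw.covariance_fun_comp hf.aemeasurable hf'.aemeasurable,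
          measurePreserving_snd.hasLaw.covariance_fun_comp hg.aemeasurable hg'.aemeasurable]
        ring

end Prod

section MaxCoord

variable {n : ℕ}

lemma le_maxCoord (x : Fin n → ℝ) (i : Fin n) : x i ≤ maxCoord x :=
  le_ciSup (Set.finite_range x).bddAbove i

lemma exists_eq_maxCoord [NeZero n] (x : Fin n → ℝ) : ∃ i, x i = maxCoord x :=
  exists_eq_ciSup_of_finite

lemma measurable_maxCoord : Measurable (maxCoord (n := n)) :=
  Measurable.iSup measurable_pi_apply

lemma maxCoord_const_add_mul [NeZero n] (c : ℝ) {b : ℝ} (hb : 0 ≤ b) (x : Fin n → ℝ) :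
    maxCoord (fun i => c + b * x i) = c + b * maxCoord x := by
  simp only [maxCoord]
  rw [Real.mul_iSup_of_nonneg hb, add_ciSup (Set.finite_range _).bddAbove]

lemma abs_maxCoord_le (x : Fin n → ℝ) : |maxCoord x| ≤ ‖x‖ := by
  rcases eq_zero_or_neZero n with rfl | _
  · simp [maxCoord]
  · obtain ⟨i, hi⟩ := exists_eq_maxCoord x
    exact hi ▸ norm_le_pi_norm x i

lemma memLp_maxCoord {Ω : Type*} [MeasurableSpace Ω] {P : Measure Ω} {X : Ω → Fin n → ℝ}
    {p : ENNReal} (hX : MemLp X p P) : MemLp (fun ω => maxCoord (X ω)) p P :=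
  hX.of_le (measurable_maxCoord.comp_aemeasurable hX.aemeasurable).aestronglyMeasurable
    (ae_of_all _ fun ω => abs_maxCoord_le (X ω))

end MaxCoord

section GaussianVector

variable {ι Ω Ω' : Type*} [MeasurableSpace Ω] [MeasurableSpace Ω'] {P : Measure Ω}
  {Q : Measure Ω'} {X : Ω → ι → ℝ} {Y : Ω' → ι → ℝ} {ρ : ℝ}

lemma identDistrib_of_hasGaussianLaw_of_covariance_eq [Finite ι] (hX : HasGaussianLaw X P)
    (hY : HasGaussianLaw Y Q) (hmean : ∀ i, ∫ ω, X ω i ∂P = ∫ ω, Y ω i ∂Q)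
    (hcov : ∀ i j, cov[fun ω => X ω i, fun ω => X ω j; P] =
      cov[fun ω => Y ω i, fun ω => Y ω j; Q]) :
    IdentDistrib X Y P Q := by
  classical
  have := Fintype.ofFinite ι
  have := hX.isProbabilityMeasure
  have := hY.isProbabilityMeasure
  have hX2 (i : ι) : MemLp (fun ω => X ω i) 2 P := (hX.eval i).memLp_two
  have hY2 (i : ι) : MemLp (fun ω => Y ω i) 2 Q := (hY.eval i).memLp_two
  have := Measure.isProbabilityMeasure_map hX.aemeasurable
  have := Measure.isProbabilityMeasure_map hY.aemeasurable
  refine ⟨hX.aemeasurable, hY.aemeasurable, Measure.ext_of_charFunDual (funext fun L => ?_)⟩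
  obtain ⟨c, hc⟩ : ∃ c : ι → ℝ, ∀ x, L x = ∑ i, c i * x i :=
    ⟨fun i => L (Pi.single i 1), fun x => by
      conv_lhs => rw [pi_eq_sum_univ' x]
      simp [mul_comm]⟩
  simp only [hX.charFunDual_map_eq_fun, hY.charFunDual_map_eq_fun, hc]
  rw [integral_finsetSum _ fun i _ => ((hX2 i).integrable one_le_two).const_mul _,
    integral_finsetSum _ fun i _ => ((hY2 i).integrable one_le_two).const_mul _,
    variance_fun_sum fun i => (hX2 i).const_mul _, variance_fun_sum fun i => (hY2 i).const_mul _]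
  simp_rw [integral_const_mul, covariance_const_mul_left, covariance_const_mul_right, hmean, hcov]

/-- A centred Gaussian vector whose coordinates have unit variance and pairwise correlation `ρ`. -/
structure IsEquicorrelatedGaussian (X : Ω → ι → ℝ) (ρ : ℝ) (P : Measure Ω) : Prop where
  hasGaussianLaw : HasGaussianLaw X P
  integral_eq_zero (i : ι) : ∫ ω, X ω i ∂P = 0
  variance_eq_one (i : ι) : Var[fun ω => X ω i; P] = 1
  covariance_eq {i j : ι} (hij : i ≠ j) : cov[fun ω => X ω i, fun ω => X ω j; P] = ρ

lemma IsEquicorrelatedGaussian.identDistrib [Finite ι] (hX : IsEquicorrelatedGaussian X ρ P)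
    (hY : IsEquicorrelatedGaussian Y ρ Q) : IdentDistrib X Y P Q := by
  refine identDistrib_of_hasGaussianLaw_of_covariance_eq hX.hasGaussianLaw hY.hasGaussianLaw
    (fun i => by rw [hX.integral_eq_zero, hY.integral_eq_zero]) fun i j => ?_
  rcases eq_or_ne i j with rfl | hij
  · rw [covariance_self (hX.hasGaussianLaw.eval i).aemeasurable,
      covariance_self (hY.hasGaussianLaw.eval i).aemeasurable, hX.variance_eq_one,
      hY.variance_eq_one]
  · rw [hX.covariance_eq hij, hY.covariance_eq hij]

/-- The law of a family of independent standard Gaussian variables indexed by `ι`. -/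
noncomputable abbrev stdGaussianPi (ι : Type*) [Fintype ι] : Measure (ι → ℝ) :=
  Measure.pi fun _ => gaussianReal 0 1

lemma isEquicorrelatedGaussian_id [Fintype ι] :
    IsEquicorrelatedGaussian id 0 (stdGaussianPi ι) := by
  have heval (i : ι) : MeasurePreserving (fun x : ι → ℝ => x i) (stdGaussianPi ι)
      (gaussianReal 0 1) := measurePreserving_eval _ i
  have hindep : iIndepFun (fun i (x : ι → ℝ) => x i) (stdGaussianPi ι) :=
    iIndepFun_pi (X := fun _ => id) fun _ => aemeasurable_id
  have hgauss (i : ι) : HasGaussianLaw (fun x : ι → ℝ => x i) (stdGaussianPi ι) :=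
    (heval i).hasLaw.hasGaussianLaw
  refine ⟨iIndepFun.hasGaussianLaw hgauss hindep, fun i => ?_, fun i => ?_, fun {i j} hij => ?_⟩
  · exact integral_eval.trans integral_id_gaussianReal
  · simpa using (heval i).hasLaw.variance_eq.trans variance_id_gaussianReal
  · exact (hindep.indepFun hij).covariance_eq_zero (hgauss i).memLp_two (hgauss j).memLp_two

instance isGaussian_stdGaussianPi [Fintype ι] : IsGaussian (stdGaussianPi ι) := by
  simpa using isEquicorrelatedGaussian_id.hasGaussianLaw.isGaussian_map (P := stdGaussianPi ι)

lemma isEquicorrelatedGaussian_oneFactor [Fintype ι] (hρ₀ : 0 ≤ ρ) (hρ₁ : ρ ≤ 1) :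
    IsEquicorrelatedGaussian (fun (p : ℝ × (ι → ℝ)) i => √ρ * p.1 + √(1 - ρ) * p.2 i) ρ
      ((gaussianReal 0 1).prod (stdGaussianPi ι)) := by
  let T : ℝ × (ι → ℝ) →L[ℝ] ι → ℝ := ContinuousLinearMap.pi fun i =>
    √ρ • ContinuousLinearMap.fst ℝ ℝ (ι → ℝ) +
      √(1 - ρ) • (ContinuousLinearMap.proj i).comp (ContinuousLinearMap.snd ℝ ℝ (ι → ℝ))
  have hξ : IsEquicorrelatedGaussian (id : (ι → ℝ) → ι → ℝ) 0 (stdGaussianPi ι) :=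
    isEquicorrelatedGaussian_id
  have hZ2 : MemLp (fun z => √ρ * z) 2 (gaussianReal 0 1) :=
    (memLp_id_gaussianReal' 2 (by simp)).const_mul _
  have hξ2 (i : ι) : MemLp (fun x : ι → ℝ => √(1 - ρ) * x i) 2 (stdGaussianPi ι) :=
    (hξ.hasGaussianLaw.eval i).memLp_two.const_mul _
  have hVarZ : Var[fun z => z; gaussianReal 0 1] = 1 := variance_id_gaussianReal
  have hVarξ (i : ι) : Var[fun x : ι → ℝ => x i; stdGaussianPi ι] = 1 := hξ.variance_eq_one i
  refine ⟨IsGaussian.hasGaussianLaw_id.map T, fun i => ?_, fun i => ?_, fun {i j} hij => ?_⟩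
  · rw [integral_fst_add_snd_prod (hZ2.integrable one_le_two) ((hξ2 i).integrable one_le_two),
      integral_const_mul, integral_const_mul, integral_id_gaussianReal]
    simpa using Or.inr (hξ.integral_eq_zero i)
  · rw [variance_add_prod hZ2 (hξ2 i), variance_const_mul, variance_const_mul, hVarZ, hVarξ,
      Real.sq_sqrt hρ₀, Real.sq_sqrt (sub_nonneg.2 hρ₁)]
    ring
  · have hcov : cov[fun x : ι → ℝ => x i, fun x => x j; stdGaussianPi ι] = 0 := hξ.covariance_eq hij
    rw [covariance_fst_add_snd_prod hZ2 hZ2 (hξ2 i) (hξ2 j), covariance_self hZ2.aemeasurable,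
      variance_const_mul, hVarZ, Real.sq_sqrt hρ₀, covariance_const_mul_left,
      covariance_const_mul_right, hcov]
    ring

end GaussianVector

section EquicorrelatedMaximum

variable {n : ℕ} [NeZero n] {Ω : Type*} [MeasurableSpace Ω] {P : Measure Ω} {X : Ω → Fin n → ℝ}
  {ρ : ℝ}

lemma memLp_maxCoord_stdGaussianPi {n : ℕ} : MemLp maxCoord 2 (stdGaussianPi (Fin n)) :=
  memLp_maxCoord IsGaussian.memLp_two_id

namespace IsEquicorrelatedGaussian

lemma identDistrib_maxCoord (hX : IsEquicorrelatedGaussian X ρ P) (hρ₀ : 0 ≤ ρ) (hρ₁ : ρ ≤ 1) :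
    IdentDistrib (fun ω => maxCoord (X ω)) (fun p => √ρ * p.1 + √(1 - ρ) * maxCoord p.2) P
      ((gaussianReal 0 1).prod (stdGaussianPi (Fin n))) := by
  simpa only [Function.comp_def, maxCoord_const_add_mul _ (Real.sqrt_nonneg (1 - ρ))] using
    (hX.identDistrib (isEquicorrelatedGaussian_oneFactor hρ₀ hρ₁)).comp measurable_maxCoord

lemma integral_maxCoord (hX : IsEquicorrelatedGaussian X ρ P) (hρ₀ : 0 ≤ ρ) (hρ₁ : ρ ≤ 1) :
    ∫ ω, maxCoord (X ω) ∂P = √(1 - ρ) * ∫ x, maxCoord x ∂(stdGaussianPi (Fin n)) := by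
  have hZ : Integrable (fun z => √ρ * z) (gaussianReal 0 1) :=
    ((memLp_id_gaussianReal' 1 (by simp)).integrable le_rfl).const_mul _
  rw [(hX.identDistrib_maxCoord hρ₀ hρ₁).integral_eq, integral_fst_add_snd_prod hZ
    ((memLp_maxCoord_stdGaussianPi.integrable one_le_two).const_mul _), integral_const_mul,
    integral_const_mul, integral_id_gaussianReal, mul_zero, zero_add]

lemma variance_maxCoord (hX : IsEquicorrelatedGaussian X ρ P) (hρ₀ : 0 ≤ ρ) (hρ₁ : ρ ≤ 1) :
    Var[fun ω => maxCoord (X ω); P] = ρ + (1 - ρ) * Var[maxCoord; stdGaussianPi (Fin n)] := by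
  have hVarZ : Var[fun z => z; gaussianReal 0 1] = 1 := variance_id_gaussianReal
  have hZ : MemLp (fun z => √ρ * z) 2 (gaussianReal 0 1) :=
    (memLp_id_gaussianReal' 2 (by simp)).const_mul _
  rw [(hX.identDistrib_maxCoord hρ₀ hρ₁).variance_eq,
    variance_add_prod hZ (memLp_maxCoord_stdGaussianPi.const_mul _), variance_const_mul,
    variance_const_mul, Real.sq_sqrt hρ₀, Real.sq_sqrt (sub_nonneg.2 hρ₁), hVarZ, mul_one]

end IsEquicorrelatedGaussian

end EquicorrelatedMaximum

section FinSuccProd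

variable {α : Type*} [MeasurableSpace α] {μ : Measure α} [SigmaFinite μ] {n : ℕ}

lemma integrable_mul_prod_succ {f g : α → ℝ} (hf : Integrable f μ) (hg : Integrable g μ) :
    Integrable (fun x : Fin (n + 1) → α => f (x 0) * ∏ i : Fin n, g (x i.succ))
      (Measure.pi fun _ => μ) := by
  let F : Fin (n + 1) → α → ℝ := Fin.cons f fun _ => g
  have hF (i : Fin (n + 1)) : Integrable (F i) μ := Fin.cases hf (fun _ => hg) i
  simpa [F, Fin.prod_univ_succ] using Integrable.fintype_prod hF

lemma integral_mul_prod_succ (f g : α → ℝ) :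
    ∫ x : Fin (n + 1) → α, f (x 0) * ∏ i : Fin n, g (x i.succ) ∂(Measure.pi fun _ => μ) =
      (∫ x, f x ∂μ) * (∫ x, g x ∂μ) ^ n := by
  simpa [Fin.prod_univ_succ] using
    integral_fintype_prod_eq_prod (μ := fun _ => μ) (Fin.cons f fun _ => g : Fin (n + 1) → α → ℝ)

end FinSuccProd

section IndependentMaximum

variable {n : ℕ} {μ : Measure ℝ} [IsProbabilityMeasure μ] {b c : ℝ}

lemma sq_posPart_maxCoord_sub_le_sum [NeZero n] (b : ℝ) (x : Fin n → ℝ) :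
    (maxCoord x - b)⁺ ^ 2 ≤ ∑ i, (x i - b)⁺ ^ 2 := by
  obtain ⟨i, hi⟩ := exists_eq_maxCoord x
  rw [← hi]
  exact Finset.single_le_sum (f := fun i => (x i - b)⁺ ^ 2) (fun _ _ => sq_nonneg _)
    (Finset.mem_univ i)

lemma integral_sq_posPart_maxCoord_sub_le [NeZero n] (hμ : MemLp id 2 μ) (b : ℝ) :
    ∫ x : Fin n → ℝ, (maxCoord x - b)⁺ ^ 2 ∂(Measure.pi fun _ => μ) ≤
      n * ∫ x, (x - b)⁺ ^ 2 ∂μ := by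
  have hint : Integrable (fun x => (x - b)⁺ ^ 2) μ :=
    (hμ.sub (memLp_const b)).pos_part.integrable_sq
  have hint_eval (i : Fin n) :
      Integrable (fun x : Fin n → ℝ => (x i - b)⁺ ^ 2) (Measure.pi fun _ => μ) :=
    (measurePreserving_eval (fun _ => μ) i).integrable_comp_of_integrable hint
  calc _ ≤ ∫ x : Fin n → ℝ, ∑ i, (x i - b)⁺ ^ 2 ∂(Measure.pi fun _ => μ) :=
        integral_mono_of_nonneg (ae_of_all _ fun _ => sq_nonneg _)
          (integrable_finsetSum _ fun i _ => hint_eval i)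
          (ae_of_all _ (sq_posPart_maxCoord_sub_le_sum b))
    _ = ∑ _i : Fin n, ∫ x, (x - b)⁺ ^ 2 ∂μ := by
        rw [integral_finsetSum _ fun i _ => hint_eval i]
        exact Finset.sum_congr rfl fun i _ =>
          integral_comp_eval (μ := fun _ => μ) (f := fun x => (x - b)⁺ ^ 2)
            hint.aestronglyMeasurable
    _ = _ := by simp

/- Below the level `c` the error is carried by the coordinate `0` alone, which leaves the event that
the other `n` coordinates are at most `c` as an independent factor. -/
lemma sq_negPart_maxCoord_sub_le (hcb : c ≤ b) (x : Fin (n + 1) → ℝ) :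
    (maxCoord x - b)⁻ ^ 2 ≤
      (b - c) ^ 2 + (x 0 - b) ^ 2 * ∏ i : Fin n, (Set.Iic c).indicator 1 (x i.succ) := by
  have hprod : 0 ≤ ∏ i : Fin n, (Set.Iic c).indicator (1 : ℝ → ℝ) (x i.succ) :=
    Finset.prod_nonneg fun i _ => Set.indicator_nonneg (fun _ _ => zero_le_one) _
  rcases le_total c (maxCoord x) with hc | hc
  · have hle : (maxCoord x - b)⁻ ≤ b - c := sup_le (by linarith) (by linarith)
    nlinarith [negPart_nonneg (maxCoord x - b), mul_nonneg (sq_nonneg (x 0 - b)) hprod]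
  · have hone : ∏ i : Fin n, (Set.Iic c).indicator (1 : ℝ → ℝ) (x i.succ) = 1 :=
      Finset.prod_eq_one fun i _ =>
        Set.indicator_of_mem (Set.mem_Iic.2 ((le_maxCoord x _).trans hc)) _
    have hle : (maxCoord x - b)⁻ ≤ |x 0 - b| :=
      (negPart_anti (sub_le_sub_right (le_maxCoord x 0) b)).trans
        (sup_le (neg_le_abs _) (abs_nonneg _))
    rw [hone, mul_one, ← sq_abs (x 0 - b)]
    nlinarith [negPart_nonneg (maxCoord x - b), sq_nonneg (b - c)]

lemma integral_sq_negPart_maxCoord_sub_le (hμ : MemLp id 2 μ) (hcb : c ≤ b) :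
    ∫ x : Fin (n + 1) → ℝ, (maxCoord x - b)⁻ ^ 2 ∂(Measure.pi fun _ => μ) ≤
      (b - c) ^ 2 + (∫ x, (x - b) ^ 2 ∂μ) * μ.real (Set.Iic c) ^ n := by
  have hint : Integrable (fun x : Fin (n + 1) → ℝ =>
      (x 0 - b) ^ 2 * ∏ i : Fin n, (Set.Iic c).indicator 1 (x i.succ)) (Measure.pi fun _ => μ) :=
    integrable_mul_prod_succ (hμ.sub (memLp_const b)).integrable_sq
      ((integrable_const (1 : ℝ)).indicator measurableSet_Iic)
  calc _ ≤ ∫ x : Fin (n + 1) → ℝ, ((b - c) ^ 2 +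
          (x 0 - b) ^ 2 * ∏ i : Fin n, (Set.Iic c).indicator 1 (x i.succ))
            ∂(Measure.pi fun _ => μ) :=
        integral_mono_of_nonneg (ae_of_all _ fun _ => sq_nonneg _)
          ((integrable_const _).add hint) (ae_of_all _ (sq_negPart_maxCoord_sub_le hcb))
    _ = _ := by
        rw [integral_add (integrable_const _) hint,
          integral_mul_prod_succ (fun x => (x - b) ^ 2) ((Set.Iic c).indicator 1),
          integral_indicator_one measurableSet_Iic]
        simp

lemma integral_sq_maxCoord_sub_le (hμ : MemLp id 2 μ) (hcb : c ≤ b) :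
    ∫ x : Fin (n + 1) → ℝ, (maxCoord x - b) ^ 2 ∂(Measure.pi fun _ => μ) ≤
      (n + 1) * ∫ x, (x - b)⁺ ^ 2 ∂μ +
        ((b - c) ^ 2 + (∫ x, (x - b) ^ 2 ∂μ) * μ.real (Set.Iic c) ^ n) := by
  have hM : MemLp (fun x : Fin (n + 1) → ℝ => maxCoord x - b) 2 (Measure.pi fun _ => μ) :=
    (memLp_maxCoord (X := id) (MemLp.of_eval fun i =>
      hμ.comp_measurePreserving (measurePreserving_eval _ i))).sub (memLp_const b)
  have hsq (y : ℝ) : y ^ 2 = y⁺ ^ 2 + y⁻ ^ 2 := by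
    rcases le_total 0 y with hy | hy <;> simp [hy]
  have hpos : Integrable (fun x : Fin (n + 1) → ℝ => (maxCoord x - b)⁺ ^ 2)
      (Measure.pi fun _ => μ) := hM.pos_part.integrable_sq
  have hneg : Integrable (fun x : Fin (n + 1) → ℝ => (maxCoord x - b)⁻ ^ 2)
      (Measure.pi fun _ => μ) := hM.neg_part.integrable_sq
  simp_rw [hsq (maxCoord _ - b)]
  rw [integral_add hpos hneg]
  exact add_le_add (by exact_mod_cast integral_sq_posPart_maxCoord_sub_le hμ b)
    (integral_sq_negPart_maxCoord_sub_le hμ hcb)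

end IndependentMaximum

section Median

variable {Ω : Type*} [MeasurableSpace Ω] {P : Measure Ω}

lemma integral_sq_sub_const [IsProbabilityMeasure P] {Y : Ω → ℝ} (hY : MemLp Y 2 P) (c : ℝ) :
    ∫ ω, (Y ω - c) ^ 2 ∂P = Var[Y; P] + (∫ ω, Y ω ∂P - c) ^ 2 := by
  have h := variance_eq_sub (hY.sub (memLp_const c))
  simp only [Pi.sub_def, Pi.pow_apply] at h
  rw [variance_sub_const hY.aestronglyMeasurable,
    integral_sub (hY.integrable one_le_two) (integrable_const c)] at h
  simp at h
  linarith

lemma IsMedian.sq_sub_integral_le [IsFiniteMeasure P] {Y : Ω → ℝ} {m : ℝ} (h : IsMedian P Y m)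
    (hY : MemLp Y 2 P) : (m - ∫ ω, Y ω ∂P) ^ 2 ≤ 2 * Var[Y; P] := by
  set d := m - ∫ ω, Y ω ∂P
  rcases eq_or_ne d 0 with hd0 | hd0
  · simp [hd0, variance_nonneg]
  have hhalf : 1 / 2 ≤ P {ω | |d| ≤ |Y ω - ∫ ω, Y ω ∂P|} := by
    rcases le_total d 0 with hd' | hd'
    · refine h.1.trans (measure_mono fun ω (hω : Y ω ≤ m) => ?_)
      exact abs_le_abs_of_nonpos hd' (sub_le_sub_right hω _)
    · refine h.2.trans (measure_mono fun ω (hω : m ≤ Y ω) => ?_)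
      exact abs_le_abs_of_nonneg hd' (sub_le_sub_right hω _)
  have hcheb : 1 / 2 ≤ ENNReal.ofReal (Var[Y; P] / d ^ 2) := by
    simpa using hhalf.trans (meas_ge_le_variance_div_sq hY (abs_pos.2 hd0))
  rw [ENNReal.le_ofReal_iff_toReal_le (by simp) (div_nonneg (variance_nonneg Y P) (sq_nonneg d)),
    le_div_iff₀ (by positivity)] at hcheb
  norm_num at hcheb
  linarith

lemma tendsto_median_div {ι : Type*} {l : Filter ι} {Ω : ι → Type*} [∀ i, MeasurableSpace (Ω i)]
    {P : ∀ i, Measure (Ω i)} [∀ i, IsFiniteMeasure (P i)] {Y : ∀ i, Ω i → ℝ} {med t : ι → ℝ}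
    {b : ℝ} (hY : ∀ i, MemLp (Y i) 2 (P i)) (hmed : ∀ i, IsMedian (P i) (Y i) (med i))
    (hvar : Tendsto (fun i => Var[Y i; P i] / t i ^ 2) l (𝓝 0))
    (hmean : Tendsto (fun i => (∫ ω, Y i ω ∂(P i)) / t i) l (𝓝 b)) :
    Tendsto (fun i => med i / t i) l (𝓝 b) := by
  have hdiff : Tendsto (fun i => (med i - ∫ ω, Y i ω ∂(P i)) / t i) l (𝓝 0) := by
    have hsqrt : Tendsto (fun i => √(2 * (Var[Y i; P i] / t i ^ 2))) l (𝓝 0) := by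
      simpa only [mul_zero, Real.sqrt_zero] using (hvar.const_mul 2).sqrt
    refine squeeze_zero_norm (fun i => Real.abs_le_sqrt ?_) hsqrt
    rw [div_pow, ← mul_div_assoc]
    gcongr
    exact (hmed i).sq_sub_integral_le (hY i)
  simpa [sub_div] using hdiff.add hmean

end Median

section GaussianEstimates

lemma sq_posPart_le_exp (s : ℝ) {t : ℝ} (ht : 0 < t) : s⁺ ^ 2 ≤ 2 / t ^ 2 * Real.exp (t * s) := by
  rcases le_total s 0 with hs | hs
  · rw [posPart_eq_zero.2 hs, zero_pow two_ne_zero]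
    positivity
  · rw [posPart_eq_self.2 hs, div_mul_eq_mul_div, le_div_iff₀ (by positivity)]
    nlinarith [Real.quadratic_le_exp_of_nonneg (mul_nonneg ht.le hs), mul_nonneg ht.le hs]

lemma integral_sq_posPart_sub_gaussianReal_le {t : ℝ} (ht : 0 < t) :
    ∫ x, (x - t)⁺ ^ 2 ∂(gaussianReal 0 1) ≤ 2 / t ^ 2 * Real.exp (-(t ^ 2 / 2)) := by
  have hmgf : ∫ x, Real.exp (t * x) ∂(gaussianReal 0 1) = Real.exp (t ^ 2 / 2) := by
    simpa [mgf] using congrFun (mgf_id_gaussianReal (μ := 0) (v := 1)) t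
  calc _ ≤ ∫ x, 2 / t ^ 2 * Real.exp (-t ^ 2) * Real.exp (t * x) ∂(gaussianReal 0 1) := by
        refine integral_mono_of_nonneg (ae_of_all _ fun _ => sq_nonneg _)
          ((integrable_exp_mul_gaussianReal t).const_mul _) (ae_of_all _ fun x => ?_)
        calc _ ≤ 2 / t ^ 2 * Real.exp (t * (x - t)) := sq_posPart_le_exp (x - t) ht
          _ = 2 / t ^ 2 * Real.exp (-t ^ 2) * Real.exp (t * x) := by
            rw [mul_assoc, ← Real.exp_add]
            ring_nf
    _ = _ := by
        rw [integral_const_mul, hmgf, mul_assoc, ← Real.exp_add]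
        ring_nf

lemma integral_sq_sub_gaussianReal (b : ℝ) : ∫ x, (x - b) ^ 2 ∂(gaussianReal 0 1) = 1 + b ^ 2 := by
  have hvar : Var[fun x => x; gaussianReal 0 1] = 1 := variance_id_gaussianReal
  have hid : MemLp (fun x => x) 2 (gaussianReal 0 1) := memLp_id_gaussianReal' 2 (by simp)
  rw [integral_sq_sub_const hid b]
  simp [hvar]

lemma antitoneOn_gaussianPDFReal (μ : ℝ) (v : NNReal) :
    AntitoneOn (gaussianPDFReal μ v) (Set.Ici μ) := by
  intro x hx y _ hxy
  have hx : 0 ≤ x - μ := sub_nonneg.2 hx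
  simp only [gaussianPDFReal]
  gcongr

lemma mul_gaussianPDFReal_le_real_Ioi {μ c h : ℝ} {v : NNReal} (hv : v ≠ 0) (hc : μ ≤ c)
    (hh : 0 ≤ h) : h * gaussianPDFReal μ v (c + h) ≤ (gaussianReal μ v).real (Set.Ioi c) := by
  calc _ = ∫ _ in Set.Ioc c (c + h), gaussianPDFReal μ v (c + h) := by
        simp [hh]
    _ ≤ ∫ x in Set.Ioc c (c + h), gaussianPDFReal μ v x :=
        setIntegral_mono_on (integrableOn_const measure_Ioc_lt_top.ne)
          (integrable_gaussianPDFReal μ v).integrableOn measurableSet_Ioc fun x hx =>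
            antitoneOn_gaussianPDFReal μ v (hc.trans hx.1.le)
              (hc.trans (hx.1.le.trans hx.2)) hx.2
    _ = (gaussianReal μ v).real (Set.Ioc c (c + h)) := by
        rw [measureReal_def, gaussianReal_apply_eq_integral _ hv, ENNReal.toReal_ofReal]
        exact integral_nonneg fun x => gaussianPDFReal_nonneg _ _ _
    _ ≤ _ := measureReal_mono Set.Ioc_subset_Ioi_self

/- The factor `t` is gained by evaluating the density at `t - ε / 2` instead of `t`; it makes the
expected number of exceedances of `t - ε` diverge when `n * gaussianPDFReal 0 1 t` is bounded
below. -/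
lemma mul_gaussianPDFReal_le_real_Ioi_sub {t ε : ℝ} (hε : 0 ≤ ε) (hεt : ε ≤ t) :
    ε ^ 2 / 4 * Real.exp (-(ε ^ 2 / 8)) * (t * gaussianPDFReal 0 1 t) ≤
      (gaussianReal 0 1).real (Set.Ioi (t - ε)) := by
  have hpdf : gaussianPDFReal 0 1 (t - ε / 2) =
      Real.exp (t * ε / 2) * Real.exp (-(ε ^ 2 / 8)) * gaussianPDFReal 0 1 t := by
    simp only [gaussianPDFReal]
    rw [mul_left_comm, ← Real.exp_add, ← Real.exp_add]
    congr 2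
    push_cast
    ring
  calc _ = ε / 2 * ((t * ε / 2) * Real.exp (-(ε ^ 2 / 8)) * gaussianPDFReal 0 1 t) := by ring
    _ ≤ ε / 2 * (Real.exp (t * ε / 2) * Real.exp (-(ε ^ 2 / 8)) * gaussianPDFReal 0 1 t) := by
        have hexp : t * ε / 2 ≤ Real.exp (t * ε / 2) := by
          linarith [Real.add_one_le_exp (t * ε / 2)]
        have hpdf0 := gaussianPDFReal_nonneg 0 1 t
        gcongr
    _ = ε / 2 * gaussianPDFReal 0 1 (t - ε + ε / 2) := by rw [← hpdf]; ring_nf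
    _ ≤ _ := mul_gaussianPDFReal_le_real_Ioi one_ne_zero (sub_nonneg.2 hεt) (by positivity)

lemma integral_sq_maxCoord_sub_stdGaussianPi_le {n : ℕ} {t ε : ℝ} (hε : 0 < ε) (hεt : ε ≤ t) :
    ∫ x, (maxCoord x - t) ^ 2 ∂(stdGaussianPi (Fin (n + 1))) ≤
      (n + 1) * (2 / t ^ 2 * Real.exp (-(t ^ 2 / 2))) + (ε ^ 2 + (1 + t ^ 2) *
        Real.exp (-(n * (ε ^ 2 / 4 * Real.exp (-(ε ^ 2 / 8)) * (t * gaussianPDFReal 0 1 t))))) := by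
  have hIic : (gaussianReal 0 1).real (Set.Iic (t - ε)) ≤
      Real.exp (-(ε ^ 2 / 4 * Real.exp (-(ε ^ 2 / 8)) * (t * gaussianPDFReal 0 1 t))) := by
    rw [← Set.compl_Ioi, probReal_compl_eq_one_sub measurableSet_Ioi]
    exact (sub_le_sub_left (mul_gaussianPDFReal_le_real_Ioi_sub hε.le hεt) 1).trans
      (Real.one_sub_le_exp_neg _)
  refine (integral_sq_maxCoord_sub_le (memLp_id_gaussianReal' 2 (by simp))
    (sub_le_self t hε.le)).trans ?_
  rw [sub_sub_cancel, integral_sq_sub_gaussianReal, neg_mul_eq_mul_neg, Real.exp_nat_mul]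
  gcongr
  exact integral_sq_posPart_sub_gaussianReal_le (hε.trans_le hεt)

end GaussianEstimates

section IndependentGaussianMaximum

lemma tendsto_sqrt_two_log_atTop : Tendsto (fun n : ℕ => √(2 * Real.log n)) atTop atTop :=
  Real.tendsto_sqrt_atTop.comp
    ((Real.tendsto_log_atTop.comp tendsto_natCast_atTop_atTop).const_mul_atTop two_pos)

lemma sq_sqrt_two_log (n : ℕ) : √(2 * Real.log n) ^ 2 = 2 * Real.log n :=
  Real.sq_sqrt (mul_nonneg two_pos.le (Real.log_natCast_nonneg n))

lemma tendsto_one_add_sq_mul_exp_neg {k : ℝ} (hk : 0 < k) :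
    Tendsto (fun t : ℝ => (1 + t ^ 2) * Real.exp (-(k * t))) atTop (𝓝 0) := by
  have hkt : Tendsto (fun t : ℝ => k * t) atTop atTop := tendsto_id.const_mul_atTop hk
  have h₀ := (Real.tendsto_pow_mul_exp_neg_atTop_nhds_zero 0).comp hkt
  have h₂ := ((Real.tendsto_pow_mul_exp_neg_atTop_nhds_zero 2).comp hkt).const_mul (k ^ 2)⁻¹
  refine (by simpa using h₀.add h₂ : Tendsto _ _ (𝓝 (0 : ℝ))).congr fun t => ?_
  field_simp

lemma integral_sq_maxCoord_sub_stdGaussianPi_le_of_sq_eq_two_log {n : ℕ} {t ε : ℝ} (hn : 1 ≤ n)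
    (hε : 0 < ε) (hεt : ε ≤ t) (ht : t ^ 2 = 2 * Real.log (n + 1)) :
    ∫ x, (maxCoord x - t) ^ 2 ∂(stdGaussianPi (Fin (n + 1))) ≤ 2 / t ^ 2 + (ε ^ 2 + (1 + t ^ 2) *
      Real.exp (-(ε ^ 2 / 8 * Real.exp (-(ε ^ 2 / 8)) * (√(2 * Real.pi))⁻¹ * t))) := by
  have ht₀ : 0 < t := hε.trans_le hεt
  have hexp : Real.exp (-(t ^ 2 / 2)) = (n + 1 : ℝ)⁻¹ := by
    rw [ht, mul_div_cancel_left₀ _ two_ne_zero, Real.exp_neg, Real.exp_log (by positivity)]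
  have hpdf : gaussianPDFReal 0 1 t = (√(2 * Real.pi))⁻¹ * (n + 1 : ℝ)⁻¹ := by
    simp [gaussianPDFReal, ← hexp, neg_div]
  have hhalf : (1 / 2 : ℝ) ≤ n * (n + 1 : ℝ)⁻¹ := by
    have hn' : (1 : ℝ) ≤ n := by exact_mod_cast hn
    rw [← div_eq_mul_inv, div_le_div_iff₀ two_pos (by positivity)]
    linarith
  refine (integral_sq_maxCoord_sub_stdGaussianPi_le hε hεt).trans ?_
  rw [hexp, hpdf]
  gcongr ?_ + (_ + _ * Real.exp (-?_))
  · exact le_of_eq (by field_simp)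
  · calc _ = 1 / 2 * (ε ^ 2 / 4 * Real.exp (-(ε ^ 2 / 8)) * (t * (√(2 * Real.pi))⁻¹)) := by ring
      _ ≤ n * (n + 1 : ℝ)⁻¹ *
          (ε ^ 2 / 4 * Real.exp (-(ε ^ 2 / 8)) * (t * (√(2 * Real.pi))⁻¹)) := by gcongr
      _ = _ := by ring

lemma tendsto_integral_sq_maxCoord_sub_stdGaussianPi :
    Tendsto (fun n : ℕ => ∫ x, (maxCoord x - √(2 * Real.log n)) ^ 2 ∂(stdGaussianPi (Fin n)))
      atTop (𝓝 0) := by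
  refine tendsto_order.2 ⟨fun δ hδ => Eventually.of_forall fun n =>
    hδ.trans_le (integral_nonneg fun _ => sq_nonneg _), fun δ hδ => ?_⟩
  obtain ⟨ε, hε, hεδ⟩ : ∃ ε : ℝ, 0 < ε ∧ ε ^ 2 < δ :=
    ⟨√(δ / 2), by positivity, by rw [Real.sq_sqrt (by positivity)]; exact half_lt_self hδ⟩
  have hbound := ((tendsto_pow_atTop two_ne_zero).const_div_atTop 2).add
    ((tendsto_one_add_sq_mul_exp_neg (k := ε ^ 2 / 8 * Real.exp (-(ε ^ 2 / 8)) *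
      (√(2 * Real.pi))⁻¹) (by positivity)).const_add (ε ^ 2))
  rw [add_zero, zero_add] at hbound
  filter_upwards [tendsto_sqrt_two_log_atTop.eventually (hbound.eventually_lt_const hεδ),
    tendsto_sqrt_two_log_atTop.eventually_ge_atTop ε, eventually_ge_atTop 2] with n hlt hεn hn
  obtain ⟨m, rfl⟩ : ∃ m, n = m + 1 := ⟨n - 1, by lia⟩
  refine lt_of_le_of_lt
    (integral_sq_maxCoord_sub_stdGaussianPi_le_of_sq_eq_two_log (by lia) hε hεn ?_) hlt
  rw [sq_sqrt_two_log, Nat.cast_succ]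

lemma tendsto_variance_maxCoord_stdGaussianPi :
    Tendsto (fun n : ℕ => Var[maxCoord; stdGaussianPi (Fin n)]) atTop (𝓝 0) := by
  refine squeeze_zero (fun n => variance_nonneg _ _) (fun n => ?_)
    tendsto_integral_sq_maxCoord_sub_stdGaussianPi
  rw [integral_sq_sub_const memLp_maxCoord_stdGaussianPi]
  exact le_add_of_nonneg_right (sq_nonneg _)

lemma tendsto_integral_maxCoord_stdGaussianPi_sub :
    Tendsto (fun n : ℕ => ∫ x, maxCoord x ∂(stdGaussianPi (Fin n)) - √(2 * Real.log n))
      atTop (𝓝 0) := by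
  refine squeeze_zero_norm (fun n => Real.abs_le_sqrt ?_)
    (by simpa only [Real.sqrt_zero] using tendsto_integral_sq_maxCoord_sub_stdGaussianPi.sqrt)
  rw [integral_sq_sub_const memLp_maxCoord_stdGaussianPi]
  exact le_add_of_nonneg_left (variance_nonneg _ _)

lemma tendsto_integral_maxCoord_stdGaussianPi_div :
    Tendsto (fun n : ℕ => (∫ x, maxCoord x ∂(stdGaussianPi (Fin n))) / √(2 * Real.log n))
      atTop (𝓝 1) := by
  have hsub := (tendsto_integral_maxCoord_stdGaussianPi_sub.div_atTop
    tendsto_sqrt_two_log_atTop).add_const 1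
  rw [zero_add] at hsub
  refine hsub.congr' ?_
  filter_upwards [tendsto_sqrt_two_log_atTop.eventually_ne_atTop 0] with n hn
  rw [sub_div, div_self hn, sub_add_cancel]

end IndependentGaussianMaximum

section EquicorrelatedAsymptotics

variable {Ω : ℕ → Type*} [∀ n, MeasurableSpace (Ω n)] {P : ∀ n, Measure (Ω n)}
  {X : ∀ n, Ω n → Fin n → ℝ} {ρ : ℝ}

lemma tendsto_variance_maxCoord_of_isEquicorrelatedGaussian
    (hX : ∀ n, IsEquicorrelatedGaussian (X n) ρ (P n)) (hρ₀ : 0 ≤ ρ) (hρ₁ : ρ ≤ 1) :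
    Tendsto (fun n => Var[fun ω => maxCoord (X n ω); P n]) atTop (𝓝 ρ) := by
  have hlim := (tendsto_variance_maxCoord_stdGaussianPi.const_mul (1 - ρ)).const_add ρ
  rw [mul_zero, add_zero] at hlim
  refine hlim.congr' ?_
  filter_upwards [eventually_ne_atTop 0] with n hn
  have : NeZero n := ⟨hn⟩
  exact ((hX n).variance_maxCoord hρ₀ hρ₁).symm

lemma tendsto_integral_maxCoord_div_of_isEquicorrelatedGaussian
    (hX : ∀ n, IsEquicorrelatedGaussian (X n) ρ (P n)) (hρ₀ : 0 ≤ ρ) (hρ₁ : ρ ≤ 1) :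
    Tendsto (fun n => (∫ ω, maxCoord (X n ω) ∂(P n)) / √(2 * Real.log n)) atTop
      (𝓝 √(1 - ρ)) := by
  have hlim := tendsto_integral_maxCoord_stdGaussianPi_div.const_mul √(1 - ρ)
  rw [mul_one] at hlim
  refine hlim.congr' ?_
  filter_upwards [eventually_ne_atTop 0] with n hn
  have : NeZero n := ⟨hn⟩
  rw [(hX n).integral_maxCoord hρ₀ hρ₁, mul_div_assoc]

lemma tendsto_median_maxCoord_div_of_isEquicorrelatedGaussian
    (hX : ∀ n, IsEquicorrelatedGaussian (X n) ρ (P n)) (hρ₀ : 0 ≤ ρ) (hρ₁ : ρ ≤ 1) {med : ℕ → ℝ}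
    (hmed : ∀ n, IsMedian (P n) (fun ω => maxCoord (X n ω)) (med n)) :
    Tendsto (fun n => med n / √(2 * Real.log n)) atTop (𝓝 √(1 - ρ)) := by
  have (n : ℕ) : IsProbabilityMeasure (P n) := (hX n).hasGaussianLaw.isProbabilityMeasure
  exact tendsto_median_div (fun n => memLp_maxCoord (hX n).hasGaussianLaw.memLp_two) hmed
    ((tendsto_variance_maxCoord_of_isEquicorrelatedGaussian hX hρ₀ hρ₁).div_atTop
      ((tendsto_pow_atTop two_ne_zero).comp tendsto_sqrt_two_log_atTop))
    (tendsto_integral_maxCoord_div_of_isEquicorrelatedGaussian hX hρ₀ hρ₁)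

end EquicorrelatedAsymptotics

theorem proposition4p3
    (ρ₀ : ℝ) (hρ₀ : 0 < ρ₀) (hρ₁ : ρ₀ < 1)
    (Ω : ℕ → Type*) [∀ n, MeasurableSpace (Ω n)]
    (P : ∀ n, Measure (Ω n)) [∀ n, IsProbabilityMeasure (P n)]
    (X : ∀ n, Ω n → Fin n → ℝ)
    (hX : ∀ n, HasGaussianLaw (X n) (P n))
    (hmean : ∀ n (i : Fin n), ∫ ω, X n ω i ∂(P n) = 0)
    (hvar : ∀ n (i : Fin n), Var[fun ω => X n ω i; P n] = 1)
    (hcorr : ∀ n (i j : Fin n), i ≠ j → corrMatrix (P n) (X n) i j = ρ₀)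
    (med : ℕ → ℝ)
    (hmed : ∀ n, IsMedian (P n) (fun ω => maxCoord (X n ω)) (med n)) :
    Tendsto
      (fun n : ℕ =>
        med n ^ 2 / Var[fun ω => maxCoord (X n ω); P n] * (1 / (2 * Real.log n)))
      atTop (𝓝 ((1 - ρ₀) / ρ₀)) := by
  have hX' n : IsEquicorrelatedGaussian (X n) ρ₀ (P n) :=
    ⟨hX n, hmean n, hvar n, fun hij => by simpa [corrMatrix, hvar] using hcorr n _ _ hij⟩
  have hmed_lim := tendsto_median_maxCoord_div_of_isEquicorrelatedGaussian hX' hρ₀.le hρ₁.le hmed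
  have hvar_lim := tendsto_variance_maxCoord_of_isEquicorrelatedGaussian hX' hρ₀.le hρ₁.le
  have hlim := (hmed_lim.pow 2).div hvar_lim hρ₀.ne'
  rw [Real.sq_sqrt (sub_nonneg.2 hρ₁.le)] at hlim
  refine hlim.congr fun n => ?_
  rw [Pi.div_apply, div_pow, sq_sqrt_two_log, div_right_comm, mul_one_div]
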